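/- Let $p$ be a prime, let $s,m\ge 1$ and $t\ge 2$ be integers, let $\epsilon\in\{1,-1\}$, and put $r=p^{st(m-1)}\bigl(p^{s(t-1)}-1\bigr)$. Let $V=\mathbb{F}_{p^{st}}^{\,2m}$, regarded as an additive group. Then there is a subset $D\subseteq V$ with $0\notin D$ and $-D=D$ such that the Cayley graph $\mathrm{Cay}(V,D)$ (with vertex set $V$, two vertices being adjacent if and only if their difference lies in $D$) is neither complete nor edgeless and is a strongly regular graph with parameters $$\bigl(p^{2stm},\ (p^{stm}-\epsilon)r,\ \epsilon p^{stm}+r^2-3\epsilon r,\ r^2-\epsilon r\bigr).$$ Here a graph is strongly regular with parameters $(v,k,\lambda,\mu)$ if it has $v$ vertices, is $k$-regular, any two adjacent vertices have exactly $\lambda$ common neighbours, and any two distinct nonadjacent vertices have exactly $\mu$ common neighbours. -/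

import Mathlib

/-- `G` is a strongly regular graph with integer parameters `(v, k, l, μ)`: it is neither edgeless
nor complete, it has `v` vertices and is `k`-regular, any two adjacent vertices have exactly `l`
common neighbours, and any two distinct nonadjacent vertices have exactly `μ` common neighbours.
The parameters are integers so that expressions with signs can be written without truncation. -/
def IsStronglyRegular {V : Type*} [Fintype V] (G : SimpleGraph V) (v k l μ : ℤ) : Prop :=
  G ≠ ⊥ ∧ G ≠ ⊤ ∧
    ∃ v' k' l' μ' : ℕ, (v' : ℤ) = v ∧ (k' : ℤ) = k ∧ (l' : ℤ) = l ∧ (μ' : ℤ) = μ ∧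
      letI := Classical.decEq V
      letI := Classical.decRel G.Adj
      G.IsSRGWith v' k' l' μ'

/-! Take finite fields K ⊂ L ⊂ E of orders p^s, p^(st), n = p^(stm) and a nondegenerate quadratic
form Q over E on a space of order n², with all Gauss sums ∑ ψ(cQ(x)), c ≠ 0, equal to εn: the
hyperbolic plane for ε = 1, the norm form of the quadratic extension for ε = -1. Let D be the set
where Q lies in K^⊥ but not in L^⊥, annihilators being taken with respect to ψ. The indicator of Q ∈
K^⊥ is the average of ψ(cQ) over c ∈ K. Completing the square sends ψ(cQ) to εn·ψ(-c⁻¹Q), and c ↦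
-c⁻¹ permutes K \ {0}, so this indicator is its own Fourier transform up to constants and a delta at
0. Subtracting the same statement for L gives it for D, with r = n/|K| - n/|L|. Squaring the
transform and inverting yields the common-neighbour counts. The graph uses only addition, so D may
be carried to F^(2m) by any additive isomorphism. -/

/-! ### Self-dual sets and strongly regular Cayley graphs -/

open Finset in
/-- A set `D` whose indicator function is, up to an affine change, its own Fourier transform with
respect to a symmetric bicharacter `e` has an autocorrelation taking two values off `0`. -/
theorem card_filter_sub_mem_of_self_dual {V : Type*} [AddCommGroup V] [Fintype V] [DecidableEq V]
    (D : Finset V) (h0 : 0 ∉ D) (hneg : ∀ x, x ∈ D ↔ -x ∈ D) (e : V → AddChar V ℂ)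
    (hsymm : ∀ x y, e x y = e y x) {n ε r : ℂ} (hn : n ≠ 0) (hε : ε ^ 2 = 1)
    (he : ∀ x, ∑ b, e b x = if x = 0 then n ^ 2 else 0)
    (hD : ∀ b, ∑ x ∈ D, e b x =
      n * r * (if b = 0 then 1 else 0) + ε * n * (if b ∈ D then 1 else 0) - ε * r)
    {d : V} (hd : d ≠ 0) :
    (#{x ∈ D | d - x ∈ D} : ℂ) = r ^ 2 - ε * r + ε * (n - 2 * r) * (if d ∈ D then 1 else 0) := by
  -- Fourier inversion: the squared transform of the indicator is the transform of its
  -- self-convolution.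
  have key : n ^ 2 * (#{x ∈ D | d - x ∈ D} : ℂ) = ∑ b, (∑ x ∈ D, e b x) ^ 2 * e b (-d) := by
    have h1 : ∀ b, (∑ x ∈ D, e b x) ^ 2 * e b (-d) = ∑ x ∈ D, ∑ y ∈ D, e b (x + y - d) := by
      intro b
      rw [sq, sum_mul_sum, sum_mul]
      refine sum_congr rfl fun x _ ↦ ?_
      rw [sum_mul]
      refine sum_congr rfl fun y _ ↦ ?_
      rw [sub_eq_add_neg, AddChar.map_add_eq_mul, AddChar.map_add_eq_mul]
    simp_rw [h1]
    rw [sum_comm, card_filter, Nat.cast_sum, mul_sum]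
    refine sum_congr rfl fun x _ ↦ ?_
    rw [sum_comm]
    simp_rw [he]
    have h2 : ∀ y, x + y - d = 0 ↔ d - x = y := fun y ↦ by
      rw [sub_eq_zero, sub_eq_iff_eq_add', eq_comm]
    simp_rw [h2, sum_ite_eq]
    split_ifs <;> simp
  have hδ : ∑ b, (if b = 0 then 1 else 0) * e b (-d) = 1 := by
    simp [hsymm 0]
  have hf : ∑ b, (if b ∈ D then 1 else 0) * e b (-d) =
      ε * n * (if d ∈ D then 1 else 0) - ε * r := by
    have := hD (-d)
    rw [if_neg (neg_ne_zero.2 hd), mul_zero, zero_add] at this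
    simp_rw [← hneg] at this
    rw [← this]
    simp [hsymm (-d)]
  have h1 : ∑ b, e b (-d) = 0 := by rw [he, if_neg (neg_ne_zero.2 hd)]
  -- As 0 ∉ D, the transform is constant on each of {0}, D and the rest, so its square is again a
  -- combination of the two indicators and 1.
  have hsq : ∀ b, (∑ x ∈ D, e b x) ^ 2 * e b (-d) =
      (n ^ 2 * r ^ 2 - 2 * ε * n * r ^ 2) * ((if b = 0 then 1 else 0) * e b (-d)) +
      (n ^ 2 - 2 * n * r) * ((if b ∈ D then 1 else 0) * e b (-d)) + r ^ 2 * e b (-d) := by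
    intro b
    rw [hD]
    by_cases hb : b = 0
    · subst hb
      simp only [h0, if_true, if_false]
      linear_combination r ^ 2 * e 0 (-d) * hε
    · by_cases hb' : b ∈ D
      · simp only [hb, hb', if_true, if_false]
        linear_combination (n - r) ^ 2 * e b (-d) * hε
      · simp only [hb, hb', if_false]
        linear_combination r ^ 2 * e b (-d) * hε
  simp_rw [hsq] at key
  rw [sum_add_distrib, sum_add_distrib, ← mul_sum, ← mul_sum, ← mul_sum, hδ, hf, h1] at key
  apply mul_left_cancel₀ (pow_ne_zero 2 hn)
  rw [key]
  ring

open Finset in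
/-- The Cayley graph of a symmetric set whose autocorrelation takes one value on the set and one
value off it is strongly regular. -/
theorem isStronglyRegular_addCayley {V : Type*} [AddCommGroup V] [Fintype V] [DecidableEq V]
    (D : Finset V) (h0 : 0 ∉ D) (hneg : ∀ x, x ∈ D ↔ -x ∈ D) {v k l μ : ℤ}
    (hv : (Fintype.card V : ℤ) = v) (hk : (#D : ℤ) = k) (hk0 : 0 < k) (hkv : k < v - 1)
    (hl : ∀ d ∈ D, (#{x ∈ D | d - x ∈ D} : ℤ) = l)
    (hμ : ∀ d ∉ D, d ≠ 0 → (#{x ∈ D | d - x ∈ D} : ℤ) = μ) :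
    IsStronglyRegular (SimpleGraph.addCayley (D : Set V)) v k l μ := by
  have hadj : ∀ u w, (SimpleGraph.addCayley (D : Set V)).Adj u w ↔ w - u ∈ D := by
    intro u w
    rw [SimpleGraph.addCayley_adj']
    constructor
    · rintro ⟨-, g, hg, rfl | rfl⟩
      · simpa using hg
      · rw [hneg]; simpa using hg
    · intro h
      refine ⟨?_, w - u, h, Or.inl (by abel)⟩
      rintro rfl
      exact h0 (by simpa using h)
  obtain ⟨d₁, hd₁⟩ : D.Nonempty := card_pos.1 (by omega)
  obtain ⟨d₂, hd₂, hd₂0⟩ : ∃ d, d ∉ D ∧ d ≠ 0 := by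
    by_contra! h
    have : univ ⊆ insert 0 D := fun x _ ↦ by
      rw [mem_insert]; by_contra! hx; exact hx.1 (h x hx.2)
    have := card_le_card this
    rw [card_insert_of_notMem h0, card_univ] at this
    omega
  -- Substitute x = u - a; by symmetry of D, u - b ∈ D means (b - a) - x ∈ D.
  have hcount : ∀ a b (inst : Fintype ((SimpleGraph.addCayley (D : Set V)).commonNeighbors a b)),
      @Fintype.card _ inst = #{x ∈ D | (b - a) - x ∈ D} := by
    intro a b inst
    rw [← Fintype.card_coe]
    refine Fintype.card_congr ((Equiv.subRight a).subtypeEquiv fun u ↦ ?_)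
    rw [SimpleGraph.mem_commonNeighbors, hadj, hadj, mem_filter, Equiv.subRight_apply,
      sub_sub_sub_cancel_right, hneg (u - b), neg_sub]
  have hdeg : ∀ u (inst : Fintype ((SimpleGraph.addCayley (D : Set V)).neighborSet u)),
      (SimpleGraph.addCayley (D : Set V)).degree u = #D := by
    intro u inst
    rw [← SimpleGraph.card_neighborSet_eq_degree, ← Fintype.card_coe]
    refine Fintype.card_congr ((Equiv.subRight u).subtypeEquiv fun w ↦ ?_)
    rw [SimpleGraph.mem_neighborSet, hadj, Equiv.subRight_apply]
  refine ⟨fun h ↦ ?_, fun h ↦ ?_, Fintype.card V, #D, #{x ∈ D | d₁ - x ∈ D},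
    #{x ∈ D | d₂ - x ∈ D}, hv, hk, hl _ hd₁, hμ _ hd₂ hd₂0, ?_⟩
  · have := (hadj 0 d₁).2 (by simpa using hd₁)
    simp [h] at this
  · have := (hadj 0 d₂).1 (by rw [h]; exact hd₂0.symm)
    exact hd₂ (by simpa using this)
  · refine @SimpleGraph.IsSRGWith.mk _ _ _ (Classical.decRel _) _ _ _ _ rfl ?_ ?_ ?_
    · exact fun u ↦ hdeg u _
    · intro a b hab
      rw [hcount]
      exact_mod_cast (hl _ ((hadj _ _).1 hab)).trans (hl _ hd₁).symm
    · intro a b hne hab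
      rw [hcount]
      exact_mod_cast (hμ _ (fun h ↦ hab ((hadj _ _).2 h)) (sub_ne_zero.2 hne.symm)).trans
        (hμ _ hd₂ hd₂0).symm

/-! ### Fourier transforms attached to quadratic forms -/

section QuadraticForm

variable {E V : Type*} [Field E] [AddCommGroup V] [Module E V]

/-- Completing the square in a quadratic exponential sum. -/
theorem sum_addChar_quadraticForm_mul_polar [Fintype V] (ψ : AddChar E ℂ) (Q : QuadraticForm E V)
    {c : E} (hc : c ≠ 0) (b : V) :
    ∑ x, ψ (c * Q x) * ψ (QuadraticMap.polar Q b x) =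
      (∑ x, ψ (c * Q x)) * ψ (-c⁻¹ * Q b) := by
  -- Translating by c⁻¹b needs no division by 2, because the polar form is used; p = 2 is thus
  -- included.
  rw [← Equiv.sum_comp (Equiv.addRight (c⁻¹ • b)) fun x ↦ ψ (c * Q x), Finset.sum_mul]
  refine Finset.sum_congr rfl fun x _ ↦ ?_
  rw [← AddChar.map_add_eq_mul, ← AddChar.map_add_eq_mul]
  congr 1
  rw [Equiv.coe_addRight, QuadraticMap.map_add Q, QuadraticMap.map_smul,
    QuadraticMap.polar_smul_right, QuadraticMap.polar_comm Q x b]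
  simp only [smul_eq_mul]
  field_simp
  ring

/-- The annihilator, under the pairing `(c, y) ↦ ψ (c * y)`, of the image of a field in `E`. -/
def addCharAnnihilator {K : Type*} [Field K] (ψ : AddChar E ℂ) (i : K →+* E) : Set E :=
  {y | ∀ c, ψ (i c * y) = 1}

theorem sum_addChar_mul_eq_ite {K : Type*} [Field K] [Fintype K] (ψ : AddChar E ℂ) (i : K →+* E)
    (y : E) [Decidable (y ∈ addCharAnnihilator ψ i)] :
    ∑ c, ψ (i c * y) = if y ∈ addCharAnnihilator ψ i then (Fintype.card K : ℂ) else 0 := by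
  classical
  have := AddChar.sum_eq_ite (ψ.compAddMonoidHom ((AddMonoidHom.mulRight y).comp (i : K →+ E)))
  simp only [AddChar.compAddMonoidHom_apply, AddMonoidHom.comp_apply, AddMonoidHom.mulRight_apply,
    AddMonoidHom.coe_coe] at this
  rw [this]
  refine if_congr ?_ rfl rfl
  rw [AddChar.eq_zero_iff]
  rfl

open Finset in
/-- The Fourier transform of the preimage, under a quadratic form with constant Gauss sums, of the
annihilator of a field. -/
theorem sum_ite_mem_addCharAnnihilator_mul_polar {K : Type*} [Field K] [Fintype K] [Fintype V]
    [DecidableEq V] (ψ : AddChar E ℂ) (Q : QuadraticForm E V) (i : K →+* E) {n ε : ℂ}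
    [DecidablePred (· ∈ addCharAnnihilator ψ i)]
    (hG : ∀ c, c ≠ 0 → ∑ x, ψ (c * Q x) = ε * n)
    (hB : ∀ b, ∑ x, ψ (QuadraticMap.polar Q b x) = if b = 0 then n ^ 2 else 0) (b : V) :
    ∑ x, (if Q x ∈ addCharAnnihilator ψ i then 1 else 0) * ψ (QuadraticMap.polar Q b x) =
      n ^ 2 / Fintype.card K * (if b = 0 then 1 else 0) +
      ε * n * (if Q b ∈ addCharAnnihilator ψ i then 1 else 0) - ε * n / Fintype.card K := by
  classical
  have hK : (Fintype.card K : ℂ) ≠ 0 := Nat.cast_ne_zero.2 Fintype.card_ne_zero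
  have h1 : ∀ x, (if Q x ∈ addCharAnnihilator ψ i then (1 : ℂ) else 0) =
      (∑ c, ψ (i c * Q x)) / Fintype.card K := by
    intro x
    rw [sum_addChar_mul_eq_ite]
    split_ifs
    · rw [div_self hK]
    · rw [zero_div]
  have h2 : ∑ x, (∑ c, ψ (i c * Q x)) * ψ (QuadraticMap.polar Q b x) =
      (if b = 0 then n ^ 2 else 0) + ε * n * ((∑ c, ψ (i c * Q b)) - 1) := by
    simp_rw [sum_mul]
    rw [sum_comm, ← add_sum_erase _ _ (mem_univ (0 : K))]
    congr 1
    · simp [hB]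
    -- Closure of K under inversion is what makes the transform self-dual. The convention 0⁻¹ = 0
    -- makes c ↦ -c⁻¹ a bijection of all of K, so the zero terms match.
    · have h3 : ∑ c, ψ (i c * Q b) = ∑ c : K, ψ (-(i c)⁻¹ * Q b) := by
        rw [← Equiv.sum_comp ((Equiv.inv K).trans (Equiv.neg K))]
        simp
      rw [h3, ← add_sum_erase _ _ (mem_univ (0 : K))]
      simp only [map_zero, inv_zero, neg_zero, zero_mul, AddChar.map_zero_eq_one,
        add_sub_cancel_left]
      rw [mul_sum]
      refine sum_congr rfl fun c hc ↦ ?_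
      have hc : i c ≠ 0 := (map_ne_zero i).2 (ne_of_mem_erase hc)
      rw [sum_addChar_quadraticForm_mul_polar ψ Q hc, hG _ hc]
  simp_rw [h1, div_mul_eq_mul_div]
  rw [← sum_div, h2, sum_addChar_mul_eq_ite]
  split_ifs
  all_goals field_simp; ring

end QuadraticForm

/-- The orthogonality relation for the bicharacter of a nondegenerate quadratic form. -/
theorem sum_addChar_polar {E V : Type*} [Field E] [AddCommGroup V] [Module E V] [Fintype V]
    [DecidableEq V] {ψ : AddChar E ℂ} (hψ : ψ ≠ 1) (Q : QuadraticForm E V)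
    (hQ : ∀ b, (∀ x, QuadraticMap.polar Q b x = 0) → b = 0) (b : V) :
    ∑ x, ψ (QuadraticMap.polar Q b x) = if b = 0 then (Fintype.card V : ℂ) else 0 := by
  classical
  have := AddChar.sum_eq_ite (ψ.compAddMonoidHom (Q.polarBilin b : V →+ E))
  simp only [AddChar.compAddMonoidHom_apply] at this
  refine this.trans (if_congr ?_ rfl rfl)
  constructor
  · intro h
    refine hQ b fun x ↦ ?_
    by_contra hx
    obtain ⟨y, hy⟩ := AddChar.ne_one_iff.1 hψ
    apply hy
    -- The multiple of x is chosen so that its polar value with b is y, where ψ(y) ≠ 1.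
    have := (AddChar.eq_zero_iff.1 h) ((y / QuadraticMap.polar Q b x) • x)
    rw [AddChar.compAddMonoidHom_apply] at this
    simpa [QuadraticMap.polar_smul_right, hx] using this
  · rintro rfl
    rw [AddChar.eq_zero_iff]
    intro x
    rw [AddChar.compAddMonoidHom_apply]
    simp

/-! ### The elliptic plane: the norm form -/

theorem algebraMap_norm_eq_mul_frobenius {E K : Type*} [Field E] [Fintype E] [Field K] [Algebra E K]
    [Finite K] (h2 : Module.finrank E K = 2) (x : K) :
    algebraMap E K (Algebra.norm E x) = x * FiniteField.frobeniusAlgHom E K x := by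
  have := Fintype.ofFinite K
  rw [FiniteField.algebraMap_norm_eq_pow, FiniteField.coe_frobeniusAlgHom, ← pow_succ']
  congr 1
  rw [Nat.card_eq_fintype_card, Nat.card_eq_fintype_card,
    Module.card_eq_pow_finrank (K := E) (V := K), h2]
  have h1 : 1 < Fintype.card E := Fintype.one_lt_card
  refine Nat.div_eq_of_eq_mul_left (by omega) ?_
  rw [← one_pow 2, Nat.sq_sub_sq, one_pow]

/-- The norm form of a quadratic extension of finite fields. -/
noncomputable def normForm (E K : Type*) [Field E] [Fintype E] [Field K] [Algebra E K] [Finite K]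
    (h2 : Module.finrank E K = 2) : QuadraticForm E K :=
  have hpol : ∀ x y : K, algebraMap E K (QuadraticMap.polar (Algebra.norm E) x y) =
      x * FiniteField.frobeniusAlgHom E K y + FiniteField.frobeniusAlgHom E K x * y := by
    intro x y
    simp only [QuadraticMap.polar, map_sub, algebraMap_norm_eq_mul_frobenius h2, map_add]
    ring
  QuadraticMap.ofPolar (Algebra.norm E)
    (fun a x ↦ by rw [Algebra.smul_def, map_mul, Algebra.norm_algebraMap, h2, sq, smul_eq_mul])
    (fun x x' y ↦ by
      apply (algebraMap E K).injective
      rw [map_add, hpol, hpol, hpol, map_add]; ring)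
    (fun a x y ↦ by
      apply (algebraMap E K).injective
      rw [smul_eq_mul, map_mul, hpol, hpol, map_smul, Algebra.smul_def, Algebra.smul_def]; ring)

theorem normForm_apply {E K : Type*} [Field E] [Fintype E] [Field K] [Algebra E K] [Finite K]
    (h2 : Module.finrank E K = 2) (x : K) : normForm E K h2 x = Algebra.norm E x :=
  rfl

theorem algebraMap_polar_normForm {E K : Type*} [Field E] [Fintype E] [Field K] [Algebra E K]
    [Finite K] (h2 : Module.finrank E K = 2) (x y : K) :
    algebraMap E K (QuadraticMap.polar (normForm E K h2) x y) =
      x * FiniteField.frobeniusAlgHom E K y + FiniteField.frobeniusAlgHom E K x * y := by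
  simp only [QuadraticMap.polar, map_sub, normForm_apply, algebraMap_norm_eq_mul_frobenius h2,
    map_add]
  ring

/-- With σ the Frobenius over E, a nonzero b in the radical satisfies σ(b) = -b (pair it with 1),
hence bσ(x) = bx for all x. Then σ = 1, although σ has order 2. -/
theorem normForm_nondegenerate {E K : Type*} [Field E] [Fintype E] [Field K] [Algebra E K]
    [Finite K] (h2 : Module.finrank E K = 2) (b : K)
    (h : ∀ x, QuadraticMap.polar (normForm E K h2) b x = 0) : b = 0 := by
  have h' : ∀ x, b * FiniteField.frobeniusAlgHom E K x +
      FiniteField.frobeniusAlgHom E K b * x = 0 := fun x ↦ by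
    rw [← algebraMap_polar_normForm h2, h, map_zero]
  by_contra hb
  have h1 := h' 1
  rw [map_one, mul_one, mul_one] at h1
  have hid : FiniteField.frobeniusAlgHom E K = 1 := by
    ext x
    refine mul_left_cancel₀ hb ?_
    rw [AlgHom.one_apply]
    linear_combination h' x - x * h1
  have := FiniteField.orderOf_frobeniusAlgHom E K
  rw [hid, orderOf_one, h2] at this
  omega

open Finset in
/-- The Gauss sums of the norm form are all equal to minus the order of the base field. -/
theorem sum_addChar_mul_normForm {E K : Type*} [Field E] [Fintype E] [Field K] [Algebra E K]
    [Fintype K] (h2 : Module.finrank E K = 2) {ψ : AddChar E ℂ} (hψ : ψ ≠ 1) {c : E}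
    (hc : c ≠ 0) : ∑ x, ψ (c * normForm E K h2 x) = -(Fintype.card E : ℂ) := by
  classical
  simp only [normForm_apply]
  -- Scaling x by an element of norm a / c turns one sum into the other.
  have hconst : ∀ a : E, a ≠ 0 →
      ∑ x : K, ψ (a * Algebra.norm E x) = ∑ x : K, ψ (c * Algebra.norm E x) := by
    intro a ha
    obtain ⟨z, hz⟩ := FiniteField.norm_surjective E K (a / c)
    have hz0 : z ≠ 0 := by
      rintro rfl
      rw [Algebra.norm_zero, eq_comm, div_eq_zero_iff] at hz
      exact hz.elim ha hc
    rw [← Equiv.sum_comp (Equiv.mulLeft₀ z hz0) fun x ↦ ψ (c * Algebra.norm E x)]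
    refine sum_congr rfl fun x _ ↦ ?_
    rw [Equiv.mulLeft₀_apply, map_mul (Algebra.norm E), hz, ← mul_assoc, mul_div_cancel₀ _ hc]
  -- Summing over a first leaves only x = 0. With q = |E| and G the common sum, separating a = 0
  -- gives q² + (q - 1)G = q.
  have htotal : ∑ a : E, ∑ x : K, ψ (a * Algebra.norm E x) = Fintype.card E := by
    rw [sum_comm]
    simp_rw [AddChar.sum_mulShift _ (AddChar.IsPrimitive.of_ne_one hψ)]
    simp [Algebra.norm_eq_zero_iff]
  rw [← add_sum_erase _ _ (mem_univ (0 : E)),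
    sum_congr rfl fun a ha ↦ hconst a (ne_of_mem_erase ha), sum_const, card_erase_of_mem (mem_univ _),
    card_univ, nsmul_eq_mul, Nat.cast_pred Fintype.card_pos] at htotal
  simp only [zero_mul, AddChar.map_zero_eq_one, sum_const, card_univ, nsmul_eq_mul, mul_one,
    Module.card_eq_pow_finrank (K := E) (V := K), h2, Nat.cast_pow] at htotal
  have h1 : (Fintype.card E : ℂ) - 1 ≠ 0 :=
    sub_ne_zero.2 (Nat.cast_ne_one.2 Fintype.one_lt_card.ne')
  apply mul_left_cancel₀ h1
  linear_combination htotal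

/-! ### The hyperbolic plane -/

/-- The hyperbolic plane `(x, y) ↦ x * y`. -/
def hyperbolicPlane (E : Type*) [Field E] : QuadraticForm E (E × E) :=
  QuadraticMap.linMulLin (LinearMap.fst E E E) (LinearMap.snd E E E)

theorem hyperbolicPlane_apply {E : Type*} [Field E] (x : E × E) :
    hyperbolicPlane E x = x.1 * x.2 :=
  rfl

theorem hyperbolicPlane_nondegenerate {E : Type*} [Field E] (b : E × E)
    (h : ∀ x, QuadraticMap.polar (hyperbolicPlane E) b x = 0) : b = 0 := by
  have h1 := h (1, 0)
  have h2 := h (0, 1)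
  simp only [QuadraticMap.polar, hyperbolicPlane_apply, Prod.fst_add, Prod.snd_add] at h1 h2
  ext
  · simp only [Prod.fst_zero]; linear_combination h2
  · simp only [Prod.snd_zero]; linear_combination h1

theorem sum_addChar_mul_hyperbolicPlane {E : Type*} [Field E] [Fintype E] {ψ : AddChar E ℂ}
    (hψ : ψ ≠ 1) {c : E} (hc : c ≠ 0) :
    ∑ x, ψ (c * hyperbolicPlane E x) = Fintype.card E := by
  classical
  rw [Fintype.sum_prod_type_right]
  have : ∀ x y : E, c * hyperbolicPlane E (x, y) = x * (c * y) := fun x y ↦ by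
    rw [hyperbolicPlane_apply]; ring
  simp_rw [this, AddChar.sum_mulShift _ (AddChar.IsPrimitive.of_ne_one hψ)]
  simp [hc]

/-! ### The construction from nested fields -/

open Finset in
/-- The set on which a nondegenerate quadratic form with Gauss sums `ε * n` takes values in the
difference of the annihilators of two nested fields gives a strongly regular Cayley graph, of Latin
square type if `ε = 1` and of negative Latin square type if `ε = -1`. -/
theorem exists_isStronglyRegular_addCayley {W E V K L : Type*} [Field E] [Fintype E]
    [AddCommGroup V] [Module E V] [Fintype V] [Field K] [Fintype K] [Field L] [Fintype L]
    [AddCommGroup W] [Fintype W] (φ : W ≃+ V) {ψ : AddChar E ℂ} (hψ : ψ ≠ 1)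
    (Q : QuadraticForm E V) (hQ : ∀ b, (∀ x, QuadraticMap.polar Q b x = 0) → b = 0)
    (hV : Fintype.card V = Fintype.card E ^ 2) {n ε r : ℤ} (hn : (Fintype.card E : ℤ) = n)
    (hε : ε = 1 ∨ ε = -1) (hG : ∀ c, c ≠ 0 → ∑ x, ψ (c * Q x) = ε * n)
    (j : K →+* L) (i : L →+* E)
    (hr : (n : ℂ) / Fintype.card K - n / Fintype.card L = r) (hr0 : 0 < r) (hrn : r + 1 < n) :
    ∃ D : Set W, 0 ∉ D ∧ (∀ x, x ∈ D ↔ -x ∈ D) ∧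
      IsStronglyRegular (SimpleGraph.addCayley D) (n ^ 2) ((n - ε) * r)
        (ε * n + r ^ 2 - 3 * ε * r) (r ^ 2 - ε * r) := by
  classical
  set H := addCharAnnihilator ψ (i.comp j)
  set H' := addCharAnnihilator ψ i
  have hsub : H' ⊆ H := fun y hy c ↦ hy (j c)
  let D : Finset W := {x | Q (φ x) ∈ H ∧ Q (φ x) ∉ H'}
  have hmem : ∀ x, x ∈ D ↔ Q (φ x) ∈ H ∧ Q (φ x) ∉ H' := fun x ↦ by simp [D]
  have h0 : 0 ∉ D := by
    rw [hmem]
    rintro ⟨-, h⟩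
    exact h fun c ↦ by simp
  have hneg : ∀ x, x ∈ D ↔ -x ∈ D := fun x ↦ by
    rw [hmem, hmem, map_neg, QuadraticMap.map_neg]
  let e : W → AddChar W ℂ := fun b ↦
    ψ.compAddMonoidHom ((Q.polarBilin (φ b) : V →+ E).comp (φ : W →+ V))
  have he : ∀ b x, e b x = ψ (QuadraticMap.polar Q (φ b) (φ x)) := fun b x ↦ rfl
  have hsymm : ∀ x y, e x y = e y x := fun x y ↦ by rw [he, he, QuadraticMap.polar_comm]
  have hn0 : (n : ℂ) ≠ 0 := by
    rw [← hn]; exact_mod_cast Fintype.card_ne_zero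
  have hε2 : (ε : ℂ) ^ 2 = 1 := by rcases hε with rfl | rfl <;> norm_num
  have hB : ∀ b, ∑ x, ψ (QuadraticMap.polar Q b x) = if b = 0 then (n : ℂ) ^ 2 else 0 := by
    intro b
    rw [sum_addChar_polar hψ Q hQ, hV, ← hn]
    push_cast
    rfl
  have horth : ∀ x, ∑ b, e b x = if x = 0 then (n : ℂ) ^ 2 else 0 := by
    intro x
    simp_rw [hsymm _ x, he]
    refine (Equiv.sum_comp φ.toEquiv fun y ↦ ψ (QuadraticMap.polar Q (φ x) y)).trans ?_
    rw [hB]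
    simp
  have hhat : ∀ b, ∑ x ∈ D, e b x =
      n * r * (if b = 0 then 1 else 0) + ε * n * (if b ∈ D then 1 else 0) - ε * r := by
    intro b
    have hind : ∀ y, (if y ∈ H ∧ y ∉ H' then (1 : ℂ) else 0) =
        (if y ∈ H then 1 else 0) - if y ∈ H' then 1 else 0 := by
      intro y
      by_cases h1 : y ∈ H'
      · simp [h1, hsub h1]
      · simp [h1]
    have h1 : ∑ x ∈ D, e b x = ∑ x, ((if Q x ∈ H then 1 else 0) - if Q x ∈ H' then 1 else 0) *
        ψ (QuadraticMap.polar Q (φ b) x) := by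
      rw [← Equiv.sum_comp φ.toEquiv, sum_filter]
      refine sum_congr rfl fun x _ ↦ ?_
      rw [← hind, ite_mul, one_mul, zero_mul]
      rfl
    rw [h1]
    simp_rw [sub_mul]
    rw [sum_sub_distrib, sum_ite_mem_addCharAnnihilator_mul_polar ψ Q _ hG hB,
      sum_ite_mem_addCharAnnihilator_mul_polar ψ Q _ hG hB]
    simp_rw [hmem, hind, map_eq_zero_iff φ φ.injective]
    rw [← hr]
    ring
  -- The size of D is its transform at 0.
  have hcard : (#D : ℤ) = (n - ε) * r := by
    have h1 := hhat 0
    simp only [hsymm 0, if_true, h0, if_false] at h1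
    have h2 : ∀ x, e x 0 = 1 := fun x ↦ (e x).map_zero_eq_one
    simp only [h2, sum_const, nsmul_eq_mul, mul_one] at h1
    have h3 : ((#D : ℤ) : ℂ) = (((n - ε) * r : ℤ) : ℂ) := by
      push_cast
      rw [h1]; ring
    exact_mod_cast h3
  refine ⟨D, h0, hneg, isStronglyRegular_addCayley D h0 hneg ?_ hcard ?_ ?_ ?_ ?_⟩
  · rw [Fintype.card_congr φ.toEquiv, hV, ← hn]
    push_cast
    rfl
  · rcases hε with rfl | rfl <;> nlinarith
  -- Since n² - 1 = (n - ε)(n + ε), the claim is r < n + ε; the case ε = -1 is why r + 1 < n is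
  -- assumed.
  · rcases hε with rfl | rfl <;> nlinarith
  · intro d hd
    have := card_filter_sub_mem_of_self_dual D h0 hneg e hsymm hn0 hε2 horth hhat
      (d := d) (by rintro rfl; exact h0 hd)
    rw [if_pos hd] at this
    have h3 : ((#{x ∈ D | d - x ∈ D} : ℤ) : ℂ) = ((ε * n + r ^ 2 - 3 * ε * r : ℤ) : ℂ) := by
      push_cast
      rw [this]; ring
    exact_mod_cast h3
  · intro d hd hd0
    have := card_filter_sub_mem_of_self_dual D h0 hneg e hsymm hn0 hε2 horth hhat hd0
    rw [if_neg hd] at this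
    have h3 : ((#{x ∈ D | d - x ∈ D} : ℤ) : ℂ) = ((r ^ 2 - ε * r : ℤ) : ℂ) := by
      push_cast
      rw [this]; ring
    exact_mod_cast h3

/-! ### Choice of fields and transport to F^(2m) -/

/-- Finite vector spaces over `ZMod p` of the same order are additively isomorphic. -/
theorem nonempty_addEquiv_of_card_eq (p : ℕ) [Fact p.Prime] {V W : Type*} [AddCommGroup V]
    [AddCommGroup W] [Module (ZMod p) V] [Module (ZMod p) W] [Fintype V] [Fintype W]
    (h : Fintype.card V = Fintype.card W) : Nonempty (V ≃+ W) := by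
  rw [Module.card_eq_pow_finrank (K := ZMod p), Module.card_eq_pow_finrank (K := ZMod p) (V := W),
    ZMod.card] at h
  exact ⟨(LinearEquiv.ofFinrankEq V W
    (Nat.pow_right_injective (Fact.out : p.Prime).two_le h)).toAddEquiv⟩

theorem mainTheorem9 (p s t m : ℕ) (hp : p.Prime) (hs : 1 ≤ s) (ht : 2 ≤ t) (hm : 1 ≤ m)
    (ε r : ℤ) (hε : ε = 1 ∨ ε = -1)
    (hr : r = (p : ℤ) ^ (s * t * (m - 1)) * ((p : ℤ) ^ (s * (t - 1)) - 1))
    (F : Type*) [Field F] [Fintype F] (hF : Fintype.card F = p ^ (s * t)) :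
    ∃ D : Set (Fin (2 * m) → F),
      0 ∉ D ∧ (∀ x, x ∈ D ↔ -x ∈ D) ∧
      IsStronglyRegular (SimpleGraph.addCayley D)
        ((p : ℤ) ^ (2 * s * t * m))
        (((p : ℤ) ^ (s * t * m) - ε) * r)
        (ε * (p : ℤ) ^ (s * t * m) + r ^ 2 - 3 * ε * r)
        (r ^ 2 - ε * r) := by
  classical
  have : Fact p.Prime := ⟨hp⟩
  -- From here on `t` and `m` stand for the original values minus one, which removes truncated
  -- subtraction.
  obtain ⟨t, rfl⟩ : ∃ t', t = t' + 1 := ⟨t - 1, by omega⟩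
  obtain ⟨m, rfl⟩ : ∃ m', m = m' + 1 := ⟨m - 1, by omega⟩
  simp only [Nat.add_sub_cancel] at hr
  have hs0 : s ≠ 0 := by omega
  have hst0 : s * (t + 1) ≠ 0 := mul_ne_zero hs0 (by omega)
  have hstm0 : s * (t + 1) * (m + 1) ≠ 0 := mul_ne_zero hst0 (by omega)
  let K := GaloisField p s
  let L := GaloisField p (s * (t + 1))
  let E := GaloisField p (s * (t + 1) * (m + 1))
  let E₂ := GaloisField p (s * (t + 1) * (m + 1) * 2)
  let _ : Fintype K := Fintype.ofFinite K
  let _ : Fintype L := Fintype.ofFinite L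
  let _ : Fintype E := Fintype.ofFinite E
  let _ : Fintype E₂ := Fintype.ofFinite E₂
  have hK : Fintype.card K = p ^ s := by rw [← Nat.card_eq_fintype_card, GaloisField.card _ _ hs0]
  have hL : Fintype.card L = p ^ (s * (t + 1)) := by
    rw [← Nat.card_eq_fintype_card, GaloisField.card _ _ hst0]
  have hE : Fintype.card E = p ^ (s * (t + 1) * (m + 1)) := by
    rw [← Nat.card_eq_fintype_card, GaloisField.card _ _ hstm0]
  have hE₂ : Fintype.card E₂ = Fintype.card E ^ 2 := by
    rw [← Nat.card_eq_fintype_card, GaloisField.card _ _ (mul_ne_zero hstm0 two_ne_zero), hE,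
      pow_mul]
  obtain ⟨j⟩ : Nonempty (K →ₐ[ZMod p] L) := FiniteField.nonempty_algHom_of_finrank_dvd (by
    rw [GaloisField.finrank p hs0, GaloisField.finrank p hst0]; exact dvd_mul_right _ _)
  obtain ⟨i⟩ : Nonempty (L →ₐ[ZMod p] E) := FiniteField.nonempty_algHom_of_finrank_dvd (by
    rw [GaloisField.finrank p hst0, GaloisField.finrank p hstm0]; exact dvd_mul_right _ _)
  obtain ⟨k⟩ : Nonempty (E →ₐ[ZMod p] E₂) := FiniteField.nonempty_algHom_of_finrank_dvd (by
    rw [GaloisField.finrank p hstm0, GaloisField.finrank p (mul_ne_zero hstm0 two_ne_zero)]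
    exact dvd_mul_right _ _)
  let _ : Algebra E E₂ := k.toRingHom.toAlgebra
  have h2 : Module.finrank E E₂ = 2 :=
    Nat.pow_right_injective (Fintype.one_lt_card (α := E)) <| by
      simp only [← Module.card_eq_pow_finrank, hE₂]
  obtain ⟨ψ, hψ⟩ := AddChar.exists_apply_ne_zero.2 (one_ne_zero (α := E))
  replace hψ : ψ ≠ 1 := by rintro rfl; exact hψ rfl
  have : CharP F p := charP_of_card_eq_prime_pow hF
  let _ : Algebra (ZMod p) F := ZMod.algebra F p
  have hW : Fintype.card (Fin (2 * (m + 1)) → F) = Fintype.card E ^ 2 := by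
    rw [Fintype.card_fun, Fintype.card_fin, hF, hE]; ring
  have hpos : (0 : ℤ) < p := mod_cast hp.pos
  have hp2 : (2 : ℤ) ≤ p := mod_cast hp.two_le
  have hrC : ((((p : ℤ) ^ (s * (t + 1) * (m + 1)) : ℤ) : ℂ)) / Fintype.card K -
      (((p : ℤ) ^ (s * (t + 1) * (m + 1)) : ℤ) : ℂ) / Fintype.card L = r := by
    have hpC : (p : ℂ) ≠ 0 := mod_cast hp.ne_zero
    rw [hK, hL, hr]
    push_cast
    field_simp
    ring
  have hA : (1 : ℤ) ≤ (p : ℤ) ^ (s * (t + 1) * m) := one_le_pow₀ (by omega)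
  have hB : (2 : ℤ) ≤ (p : ℤ) ^ (s * t) :=
    hp2.trans (le_self_pow₀ (by omega) (mul_ne_zero hs0 (by omega)))
  have hC : (2 : ℤ) ≤ (p : ℤ) ^ s := hp2.trans (le_self_pow₀ (by omega) hs0)
  have hr0 : 0 < r := by
    rw [hr]; exact mul_pos (by omega) (by omega)
  have hrn : r + 1 < (p : ℤ) ^ (s * (t + 1) * (m + 1)) := by
    -- Writing n = ABC for these three factors, r = A(B - 1), with A ≥ 1 and B, C ≥ 2.
    have : (p : ℤ) ^ (s * (t + 1) * (m + 1)) =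
        (p : ℤ) ^ (s * (t + 1) * m) * (p : ℤ) ^ (s * t) * (p : ℤ) ^ s := by ring
    rw [this, hr]
    nlinarith [mul_pos (show (0 : ℤ) < (p : ℤ) ^ (s * (t + 1) * m) by omega)
      (show (0 : ℤ) < (p : ℤ) ^ (s * t) by omega)]
  have hv : (p : ℤ) ^ (2 * s * (t + 1) * (m + 1)) = ((p : ℤ) ^ (s * (t + 1) * (m + 1))) ^ 2 := by
    ring
  have hn : (Fintype.card E : ℤ) = (p : ℤ) ^ (s * (t + 1) * (m + 1)) := by
    rw [hE]; push_cast; rfl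
  rw [hv]
  rcases hε with rfl | rfl
  · have hV : Fintype.card (E × E) = Fintype.card E ^ 2 := by rw [Fintype.card_prod, sq]
    obtain ⟨φ⟩ := nonempty_addEquiv_of_card_eq p (hW.trans hV.symm)
    refine exists_isStronglyRegular_addCayley φ hψ (hyperbolicPlane E)
      hyperbolicPlane_nondegenerate hV hn (Or.inl rfl) (fun c hc ↦ ?_) j.toRingHom i.toRingHom
      hrC hr0 hrn
    rw [sum_addChar_mul_hyperbolicPlane hψ hc, ← hn]
    simp
  · obtain ⟨φ⟩ := nonempty_addEquiv_of_card_eq p (hW.trans hE₂.symm)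
    refine exists_isStronglyRegular_addCayley φ hψ (normForm E E₂ h2)
      (normForm_nondegenerate h2) hE₂ hn (Or.inr rfl) (fun c hc ↦ ?_) j.toRingHom i.toRingHom
      hrC hr0 hrn
    rw [sum_addChar_mul_normForm h2 hψ hc, ← hn]
    simp
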